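/- Let $1\le m\le n$ be integers, let $0=s[0]<s[1]<\dots<s[m]=n$ be integers, let $a_1,\dots,a_{m-1}$, $d_1,\dots,d_n$ and $B$ be positive integers, and for $i\in\{1,\dots,n\}$ let $f_i:[0,d_i]\to\mathbb{R}$ be convex and lower semicontinuous (equivalently, convex and continuous on $[0,d_i]$). Define $\bar a_0=0$, $\bar a_m=B$, and recursively $$\bar a_i=\min\Big\{\bar a_{i-1}+\sum_{k=s[i-1]+1}^{s[i]}d_k,\;a_i\Big\}\qquad(1\le i\le m-1).$$ For $1\le v$ and $v-1\le w\le m$, let $\textsc{Nested}(v,w)$ with continuous variables be the problem of minimizing $\sum_{i=s[v-1]+1}^{s[w]}f_i(x_i)$ over real vectors $(x_{s[v-1]+1},\dots,x_{s[w]})$ subject to $$\sum_{k=s[v-1]+1}^{s[i]}x_k\le\bar a_i-\bar a_{v-1}\quad(v\le i\le w-1),\qquad \sum_{k=s[v-1]+1}^{s[w]}x_k=\bar a_w-\bar a_{v-1},\qquad 0\le x_i\le d_i\quad(s[v-1]<i\le s[w]);$$ for $w=v-1$ this is the trivial problem with no variables. Let $(v,t,w)$ be such that $1\le v\le t\le w\le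 m$ and $v<w$. Let $(x^{\downarrow*}_{s[v-1]+1},\dots,x^{\downarrow*}_{s[t]})$ and $(x^{\uparrow*}_{s[t]+1},\dots,x^{\uparrow*}_{s[w]})$ be optimal solutions of $\textsc{Nested}(v,t)$ and $\textsc{Nested}(t+1,w)$ with continuous variables, respectively. Then $\textsc{Nested}(v,w)$ with continuous variables admits an optimal solution $(x^{**}_{s[v-1]+1},\dots,x^{**}_{s[w]})$ such that $x^{**}_i\le x^{\downarrow*}_i$ for all $i\in\{s[v-1]+1,\dots,s[t]\}$ and $x^{**}_i\ge x^{\uparrow*}_i$ for all $i\in\{s[t]+1,\dots,s[w]\}$. -/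

import Mathlib

/-- The data of a resource allocation problem with nested constraints, with `n` variables
`x_1, …, x_n` and `m` nested constraints on the partial sums up to `s 1 < ⋯ < s m = n`:
minimize `∑ f_i (x_i)` subject to `x_1 + ⋯ + x_{s i} ≤ a_i` for `1 ≤ i ≤ m - 1`,
`x_1 + ⋯ + x_n = B` and `0 ≤ x_i ≤ d_i`. Indices start at `1`; the values of `a` outside
`{1, …, m - 1}`, of `s` outside `{0, …, m}`, of `d`, `f` outside `{1, …, n}`, and of `f i`
outside `[0, d i]` play no role. -/
structure NestedProblem where
  /-- number of variables -/
  n : ℕ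
  /-- number of nested constraints (the last one is the equality constraint) -/
  m : ℕ
  /-- last variable of each nested constraint, with the convention `s 0 = 0` -/
  s : ℕ → ℕ
  /-- right-hand sides of the nested inequality constraints -/
  a : ℕ → ℕ
  /-- upper bounds of the variables -/
  d : ℕ → ℕ
  /-- total resource -/
  B : ℕ
  /-- cost functions -/
  f : ℕ → ℝ → ℝ
  one_le_m : 1 ≤ m
  s_zero : s 0 = 0
  s_lt_succ : ∀ i < m, s i < s (i + 1)
  s_last : s m = n
  a_pos : ∀ i ∈ Finset.Ico 1 m, 0 < a i
  d_pos : ∀ i ∈ Finset.Icc 1 n, 0 < d i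
  B_pos : 0 < B
  convex : ∀ i ∈ Finset.Icc 1 n, ConvexOn ℝ (Set.Icc (0 : ℝ) (d i)) (f i)

namespace NestedProblem

/-- The tightened right-hand sides: `abar 0 = 0`, `abar m = B`, and
`abar i = min (abar (i-1) + ∑_{k = s (i-1) + 1}^{s i} d k) (a i)` for `1 ≤ i ≤ m - 1`. -/
def abar (P : NestedProblem) : ℕ → ℕ
  | 0 => 0
  | i + 1 =>
    if i + 1 = P.m then P.B
    else min (P.abar i + ∑ k ∈ Finset.Icc (P.s i + 1) (P.s (i + 1)), P.d k) (P.a (i + 1))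

/-- The indices `s (v-1) + 1, …, s w` of the variables of the subproblem `Nested(v,w)`. -/
def vars (P : NestedProblem) (v w : ℕ) : Finset ℕ :=
  Finset.Icc (P.s (v - 1) + 1) (P.s w)

/-- `x` is a feasible solution of `Nested(v,w)` with continuous variables. Only the coordinates
of `x` in `P.vars v w` matter. -/
def IsFeasible (P : NestedProblem) (v w : ℕ) (x : ℕ → ℝ) : Prop :=
  (∀ i ∈ Finset.Ico v w,
    ∑ k ∈ Finset.Icc (P.s (v - 1) + 1) (P.s i), x k ≤ (P.abar i : ℝ) - (P.abar (v - 1) : ℝ)) ∧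
  ∑ k ∈ P.vars v w, x k = (P.abar w : ℝ) - (P.abar (v - 1) : ℝ) ∧
  ∀ i ∈ P.vars v w, 0 ≤ x i ∧ x i ≤ (P.d i : ℝ)

/-- The objective of `Nested(v,w)`. -/
noncomputable def cost (P : NestedProblem) (v w : ℕ) (x : ℕ → ℝ) : ℝ :=
  ∑ i ∈ P.vars v w, P.f i (x i)

/-- `x` is an optimal solution of `Nested(v,w)` with continuous variables. -/
def IsOptimal (P : NestedProblem) (v w : ℕ) (x : ℕ → ℝ) : Prop :=
  P.IsFeasible v w x ∧ ∀ z : ℕ → ℝ, P.IsFeasible v w z → P.cost v w x ≤ P.cost v w z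

end NestedProblem

/-! Concatenating the optimal solutions of `Nested(v,t)` and `Nested(t+1,w)` gives a feasible `y`
for `Nested(v,w)` which is optimal among the feasible points whose first block has sum exactly
`abar t - abar (v-1)`. By compactness and lower semicontinuity there is, among the optimal solutions
of `Nested(v,w)`, one `x` that is closest to `y` in the `ℓ¹` distance (`exists_closest_optimal`).
This `x` has the required monotonicity.

Indeed the partial sums of `x - y` vanish at both ends and are `≤ 0` at `s t`. If some coordinate has
the wrong sign, a discrete crossing argument (`exists_exchange_pair`) finds two coordinates `i < j`
in the same block, at which `x - y` has opposite signs, such that between them the partial sums of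
the vector that is larger at `i` strictly exceed those of the other. Hence a small amount can be
moved from `i` to `j` in the first vector and from `j` to `i` in the second without leaving the
feasible sets. By convexity this does not increase the total cost, and it strictly brings the two
vectors closer (`NestedProblem.exists_shift`). As the new `y` still has the same block sums, it is
no cheaper than the old one, so the new `x` is an optimal solution closer to `y`, a contradiction. -/

/-! ### A crossing argument for sequences -/

lemma exists_descent_of_pos {D : ℕ → ℝ} {p r : ℕ} (hpr : p < r) (hp : 0 < D (p + 1))
    (hr : D r ≤ 0) :
    ∃ j, p < j ∧ j < r ∧ D (j + 1) < D j ∧ ∀ k, p < k → k ≤ j → 0 < D k := by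
  classical
  have hex : ∃ q, p < q ∧ D q ≤ 0 := ⟨r, hpr, hr⟩
  obtain ⟨h1, h2⟩ := Nat.find_spec hex
  have h3 : Nat.find hex ≤ r := Nat.find_min' hex ⟨hpr, hr⟩
  have hmin : ∀ k, k < Nat.find hex → p < k → 0 < D k := fun k hk hpk => by
    by_contra h
    exact Nat.find_min hex hk ⟨hpk, not_lt.1 h⟩
  generalize Nat.find hex = q at h1 h2 h3 hmin
  obtain ⟨j, rfl⟩ : ∃ j, q = j + 1 := ⟨q - 1, by omega⟩
  have hj : p < j := by
    rcases Nat.lt_or_ge p j with h | h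
    · exact h
    · obtain rfl : p = j := by omega
      linarith
  exact ⟨j, hj, by omega, by linarith [hmin j (by omega) hj],
    fun k hk hkj => hmin k (by omega) hk⟩

lemma exists_descent_of_neg {D : ℕ → ℝ} {l p : ℕ} (hlp : l ≤ p) (hl : 0 ≤ D l) (hp : D p < 0) :
    ∃ i, l ≤ i ∧ i < p ∧ D (i + 1) < D i ∧ ∀ k, i < k → k ≤ p → D k < 0 := by
  classical
  have h1 : l ≤ Nat.findGreatest (fun k => 0 ≤ D k) p := Nat.le_findGreatest hlp hl
  have h2 : 0 ≤ D (Nat.findGreatest (fun k => 0 ≤ D k) p) :=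
    Nat.findGreatest_spec (P := fun k => 0 ≤ D k) hlp hl
  have h3 : Nat.findGreatest (fun k => 0 ≤ D k) p ≤ p := Nat.findGreatest_le p
  have hmax : ∀ k, Nat.findGreatest (fun k => 0 ≤ D k) p < k → k ≤ p → D k < 0 :=
    fun k hk hkp => not_le.1 (Nat.findGreatest_is_greatest (P := fun k => 0 ≤ D k) hk hkp)
  generalize Nat.findGreatest (fun k => 0 ≤ D k) p = i at h1 h2 h3 hmax
  have hip : i < p := by
    rcases h3.lt_or_eq with h | rfl
    · exact h
    · linarith
  exact ⟨i, h1, hip, by linarith [hmax (i + 1) (by omega) hip], hmax⟩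

/-- If `D` starts nonnegative, ends nonpositive and increases somewhere, then it has two steps of
opposite directions between which it is strictly positive (when it first increases) or strictly
negative (when it first decreases). -/
lemma exists_exchange_pair {D : ℕ → ℝ} {l p r : ℕ} (hlp : l ≤ p) (hpr : p < r)
    (hl : 0 ≤ D l) (hr : D r ≤ 0) (hp : D p < D (p + 1)) :
    ∃ i j, l ≤ i ∧ i < j ∧ j < r ∧
      ((D i < D (i + 1) ∧ D (j + 1) < D j ∧ ∀ k, i < k → k ≤ j → 0 < D k) ∨
       (D (i + 1) < D i ∧ D j < D (j + 1) ∧ ∀ k, i < k → k ≤ j → D k < 0)) := by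
  rcases lt_or_ge 0 (D (p + 1)) with h | h
  · obtain ⟨j, h1, h2, h3, h4⟩ := exists_descent_of_pos hpr h hr
    exact ⟨p, j, hlp, h1, h2, Or.inl ⟨hp, h3, h4⟩⟩
  · obtain ⟨i, h1, h2, h3, h4⟩ := exists_descent_of_neg hlp hl (by linarith : D p < 0)
    exact ⟨i, p, h1, h2, hpr, Or.inr ⟨h3, hp, h4⟩⟩

/-- A positive number that is at most `g k` for each `k ∈ A`, if these are positive. -/
lemma Finset.exists_pos_le_of_forall_pos {ι : Type*} (A : Finset ι) (g : ι → ℝ)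
    (hg : ∀ k ∈ A, 0 < g k) : ∃ ε > 0, ∀ k ∈ A, ε ≤ g k := by
  rcases A.eq_empty_or_nonempty with rfl | hA
  · exact ⟨1, one_pos, by simp⟩
  · obtain ⟨k, hk, hmin⟩ := A.exists_min_image g hA
    exact ⟨g k, hg k hk, hmin⟩

/-- Moving the endpoints of an interval towards each other by the same amount does not increase
the sum of the values of a convex function. -/
lemma ConvexOn.add_le_add_of_sub_le {g : ℝ → ℝ} {S : Set ℝ} (hg : ConvexOn ℝ S g) {p q ε : ℝ}
    (hp : p ∈ S) (hq : q ∈ S) (hε : 0 ≤ ε) (hpq : ε ≤ q - p) :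
    g (p + ε) + g (q - ε) ≤ g p + g q := by
  rcases hε.eq_or_lt with rfl | hε
  · simp
  · have h0 : 0 < q - p := by linarith
    have hl0 : 0 ≤ ε / (q - p) := by positivity
    have hl1 : ε / (q - p) ≤ 1 := (div_le_one h0).2 hpq
    have hm : ε / (q - p) * (q - p) = ε := div_mul_cancel₀ _ h0.ne'
    generalize ε / (q - p) = c at hl0 hl1 hm
    have h1 := hg.2 hp hq (sub_nonneg.2 hl1) hl0 (by ring)
    have h2 := hg.2 hp hq hl0 (sub_nonneg.2 hl1) (by ring)
    simp only [smul_eq_mul] at h1 h2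
    rw [show (1 - c) * p + c * q = p + ε by rw [← hm]; ring] at h1
    rw [show c * p + (1 - c) * q = q - ε by rw [← hm]; ring] at h2
    linarith

/-! ### Shifting resource between two variables -/

/-- The vector `x` after an amount `ε` has been moved from coordinate `i` to coordinate `j`. -/
noncomputable def shift (x : ℕ → ℝ) (i j : ℕ) (ε : ℝ) : ℕ → ℝ :=
  fun k => x k - (if k = i then ε else 0) + (if k = j then ε else 0)

lemma sum_shift (A : Finset ℕ) (x : ℕ → ℝ) (i j : ℕ) (ε : ℝ) :
    ∑ k ∈ A, shift x i j ε k =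
      ∑ k ∈ A, x k - (if i ∈ A then ε else 0) + (if j ∈ A then ε else 0) := by
  simp only [shift, Finset.sum_add_distrib, Finset.sum_sub_distrib, Finset.sum_ite_eq']

lemma sum_shift_eq {A : Finset ℕ} (x : ℕ → ℝ) {i j : ℕ} (ε : ℝ) (h : i ∈ A ↔ j ∈ A) :
    ∑ k ∈ A, shift x i j ε k = ∑ k ∈ A, x k := by
  simp [sum_shift, h]

lemma shift_left (x : ℕ → ℝ) {i j : ℕ} (hij : i < j) (ε : ℝ) : shift x i j ε i = x i - ε := by
  simp [shift, hij.ne]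

lemma shift_right (x : ℕ → ℝ) {i j : ℕ} (hij : i < j) (ε : ℝ) : shift x i j ε j = x j + ε := by
  simp [shift, hij.ne']

lemma shift_of_ne (x : ℕ → ℝ) {i j k : ℕ} (hi : k ≠ i) (hj : k ≠ j) (ε : ℝ) :
    shift x i j ε k = x k := by
  simp [shift, hi, hj]

namespace NestedProblem

variable {P : NestedProblem} {v t w : ℕ}

lemma s_le_s (P : NestedProblem) {i j : ℕ} (hij : i ≤ j) (hj : j ≤ P.m) : P.s i ≤ P.s j := by
  induction j, hij using Nat.le_induction with
  | base => exact le_rfl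
  | succ k _ ih => exact (ih (by omega)).trans (P.s_lt_succ k (by omega)).le

lemma vars_subset (P : NestedProblem) (hwm : w ≤ P.m) : P.vars v w ⊆ Finset.Icc 1 P.n := by
  intro k hk
  have := P.s_le_s hwm le_rfl
  have := P.s_last
  simp only [vars, Finset.mem_Icc] at hk ⊢
  omega

lemma isFeasible_shift {x : ℕ → ℝ} (hx : P.IsFeasible v w x) {i j : ℕ} {ε : ℝ}
    (hi : i ∈ P.vars v w) (hj : j ∈ P.vars v w) (hij : i < j)
    (hxi : 0 ≤ x i - ε ∧ x i - ε ≤ P.d i) (hxj : 0 ≤ x j + ε ∧ x j + ε ≤ P.d j)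
    (hs : ∀ q ∈ Finset.Ico v w, i ≤ P.s q → P.s q < j →
      ∑ k ∈ Finset.Icc (P.s (v - 1) + 1) (P.s q), x k - ε ≤ (P.abar q : ℝ) - P.abar (v - 1)) :
    P.IsFeasible v w (shift x i j ε) := by
  obtain ⟨h1, h2, h3⟩ := hx
  refine ⟨fun q hq => ?_, ?_, fun k hk => ?_⟩
  · rw [sum_shift]
    simp only [vars, Finset.mem_Icc] at hi hj
    by_cases hiq : i ≤ P.s q
    · by_cases hjq : j ≤ P.s q
      · simpa [Finset.mem_Icc, hi.1, hj.1, hiq, hjq] using h1 q hq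
      · simpa [Finset.mem_Icc, hi.1, hj.1, hiq, hjq] using hs q hq hiq (by omega)
    · have hjq : ¬ j ≤ P.s q := by omega
      simpa [Finset.mem_Icc, hiq, hjq] using h1 q hq
  · rw [sum_shift_eq _ _ (by simp [hi, hj]), h2]
  · rcases eq_or_ne k i with rfl | hki
    · rwa [shift_left _ hij]
    rcases eq_or_ne k j with rfl | hkj
    · rwa [shift_right _ hij]
    rw [shift_of_ne _ hki hkj]
    exact h3 k hk

/-- The exchange step. If `u` exceeds `z` at `i`, is smaller at `j > i`, and has larger partial sums
in between, then some amount can be moved from `i` to `j` in `u` and back in `z`; this keeps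
both feasible, does not increase the total cost, and brings each of them closer to the other. -/
lemma exists_shift (hwm : w ≤ P.m) {u z : ℕ → ℝ} (hu : P.IsFeasible v w u)
    (hz : P.IsFeasible v w z) {i j : ℕ} (hi : i ∈ P.vars v w) (hj : j ∈ P.vars v w) (hij : i < j)
    (hui : z i < u i) (huj : u j < z j)
    (hs : ∀ k, i ≤ k → k < j → ∑ q ∈ Finset.Icc (P.s (v - 1) + 1) k, z q <
      ∑ q ∈ Finset.Icc (P.s (v - 1) + 1) k, u q) :
    ∃ ε, P.IsFeasible v w (shift u i j ε) ∧ P.IsFeasible v w (shift z i j (-ε)) ∧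
      P.cost v w (shift u i j ε) + P.cost v w (shift z i j (-ε)) ≤ P.cost v w u + P.cost v w z ∧
      ∑ k ∈ P.vars v w, |shift u i j ε k - z k| < ∑ k ∈ P.vars v w, |u k - z k| ∧
      ∑ k ∈ P.vars v w, |shift z i j (-ε) k - u k| < ∑ k ∈ P.vars v w, |z k - u k| := by
  obtain ⟨ε₀, hε₀, hgap⟩ := Finset.exists_pos_le_of_forall_pos (Finset.Ico i j)
    (fun k => ∑ q ∈ Finset.Icc (P.s (v - 1) + 1) k, u q -
      ∑ q ∈ Finset.Icc (P.s (v - 1) + 1) k, z q)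
    (fun k hk => sub_pos.2 (hs k (Finset.mem_Ico.1 hk).1 (Finset.mem_Ico.1 hk).2))
  obtain ⟨ε, hε, hεi, hεj, hε0⟩ : ∃ ε > 0, ε ≤ u i - z i ∧ ε ≤ z j - u j ∧ ε ≤ ε₀ :=
    ⟨min (u i - z i) (min (z j - u j) ε₀), lt_min (by linarith) (lt_min (by linarith) hε₀),
      min_le_left _ _, (min_le_right _ _).trans (min_le_left _ _),
      (min_le_right _ _).trans (min_le_right _ _)⟩
  have bui := hu.2.2 i hi
  have buj := hu.2.2 j hj
  have bzi := hz.2.2 i hi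
  have bzj := hz.2.2 j hj
  refine ⟨ε, isFeasible_shift hu hi hj hij ⟨by linarith, by linarith⟩ ⟨by linarith, by linarith⟩
      fun q hq _ _ => by linarith [hu.1 q hq],
    isFeasible_shift hz hi hj hij ⟨by linarith, by linarith⟩ ⟨by linarith, by linarith⟩
      fun q hq h1 h2 => by linarith [hu.1 q hq, hgap _ (Finset.mem_Ico.2 ⟨h1, h2⟩)], ?_, ?_, ?_⟩
  · unfold cost
    rw [← Finset.sum_add_distrib, ← Finset.sum_add_distrib]
    refine Finset.sum_le_sum fun k hk => ?_
    have hc := P.convex k (P.vars_subset hwm hk)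
    have hku : u k ∈ Set.Icc (0 : ℝ) (P.d k) := hu.2.2 k hk
    have hkz : z k ∈ Set.Icc (0 : ℝ) (P.d k) := hz.2.2 k hk
    rcases eq_or_ne k i with rfl | hki
    · have := hc.add_le_add_of_sub_le hkz hku hε.le hεi
      rw [shift_left _ hij, shift_left _ hij, sub_neg_eq_add]
      linarith
    rcases eq_or_ne k j with rfl | hkj
    · have := hc.add_le_add_of_sub_le hku hkz hε.le hεj
      rwa [shift_right _ hij, shift_right _ hij, ← sub_eq_add_neg]
    rw [shift_of_ne _ hki hkj, shift_of_ne _ hki hkj]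
  · refine Finset.sum_lt_sum (fun k _ => ?_) ⟨i, hi, ?_⟩
    · rcases eq_or_ne k i with rfl | hki
      · rw [shift_left _ hij, abs_of_nonneg (by linarith), abs_of_nonneg (by linarith)]
        linarith
      rcases eq_or_ne k j with rfl | hkj
      · rw [shift_right _ hij, abs_of_nonpos (by linarith), abs_of_nonpos (by linarith)]
        linarith
      rw [shift_of_ne _ hki hkj]
    · rw [shift_left _ hij, abs_of_nonneg (by linarith), abs_of_nonneg (by linarith)]
      linarith
  · refine Finset.sum_lt_sum (fun k _ => ?_) ⟨i, hi, ?_⟩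
    · rcases eq_or_ne k i with rfl | hki
      · rw [shift_left _ hij, abs_of_nonpos (by linarith), abs_of_nonpos (by linarith)]
        linarith
      rcases eq_or_ne k j with rfl | hkj
      · rw [shift_right _ hij, abs_of_nonneg (by linarith), abs_of_nonneg (by linarith)]
        linarith
      rw [shift_of_ne _ hki hkj]
    · rw [shift_left _ hij, abs_of_nonpos (by linarith), abs_of_nonpos (by linarith)]
      linarith

/-! ### Existence of a closest optimal solution -/

/-- The feasible solutions of `Nested(v,w)` that vanish outside `P.vars v w`. Feasibility does not
constrain the other coordinates, so it is this normalization that makes the set compact. -/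
def normalizedFeasible (P : NestedProblem) (v w : ℕ) : Set (ℕ → ℝ) :=
  {x | P.IsFeasible v w x ∧ ∀ k ∉ P.vars v w, x k = 0}

lemma isCompact_normalizedFeasible (P : NestedProblem) (v w : ℕ) :
    IsCompact (P.normalizedFeasible v w) := by
  classical
  have hK : IsCompact (Set.pi Set.univ
      fun k => Set.Icc (0 : ℝ) (if k ∈ P.vars v w then P.d k else 0)) :=
    isCompact_univ_pi fun _ => isCompact_Icc
  refine hK.of_isClosed_subset ?_ ?_
  · simp only [normalizedFeasible, IsFeasible, Set.ofPred_and, Set.ofPred_forall]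
    refine ((isClosed_biInter fun q _ => isClosed_le (by fun_prop) (by fun_prop)).inter
      ((isClosed_eq (by fun_prop) (by fun_prop)).inter
      (isClosed_biInter fun q _ => (isClosed_le (by fun_prop) (by fun_prop)).inter
        (isClosed_le (by fun_prop) (by fun_prop))))).inter
      (isClosed_biInter fun q _ => isClosed_eq (by fun_prop) (by fun_prop))
  · rintro x ⟨hx, hx0⟩ k -
    by_cases hk : k ∈ P.vars v w
    · simpa [hk] using hx.2.2 k hk
    · simp [hk, hx0 k hk]

lemma lowerSemicontinuousOn_cost (hwm : w ≤ P.m)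
    (hlsc : ∀ i ∈ Finset.Icc 1 P.n, LowerSemicontinuousOn (P.f i) (Set.Icc (0 : ℝ) (P.d i))) :
    LowerSemicontinuousOn (P.cost v w) (P.normalizedFeasible v w) := by
  refine lowerSemicontinuousOn_sum fun k hk => ?_
  exact (hlsc k (P.vars_subset hwm hk)).comp (continuous_apply k).continuousOn
    fun x hx => hx.1.2.2 k hk

lemma IsFeasible.congr {x z : ℕ → ℝ} (hwm : w ≤ P.m) (hx : P.IsFeasible v w x)
    (h : ∀ k ∈ P.vars v w, z k = x k) : P.IsFeasible v w z := by
  refine ⟨fun q hq => ?_, ?_, fun k hk => by rw [h k hk]; exact hx.2.2 k hk⟩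
  · rw [Finset.sum_congr rfl fun k hk => h k ?_]
    · exact hx.1 q hq
    · have := P.s_le_s (Finset.mem_Ico.1 hq).2.le hwm
      simp only [vars, Finset.mem_Icc] at hk ⊢
      omega
  · rw [Finset.sum_congr rfl h, hx.2.1]

lemma cost_congr {x z : ℕ → ℝ} (h : ∀ k ∈ P.vars v w, z k = x k) :
    P.cost v w z = P.cost v w x :=
  Finset.sum_congr rfl fun k hk => by rw [h k hk]

lemma exists_normalized {x : ℕ → ℝ} (hwm : w ≤ P.m) (hx : P.IsFeasible v w x) :
    ∃ z ∈ P.normalizedFeasible v w, ∀ k ∈ P.vars v w, z k = x k := by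
  classical
  refine ⟨fun k => if k ∈ P.vars v w then x k else 0, ⟨hx.congr hwm ?_, ?_⟩, ?_⟩ <;>
    intro k hk <;> simp [hk]

lemma exists_closest_optimal (hwm : w ≤ P.m)
    (hlsc : ∀ i ∈ Finset.Icc 1 P.n, LowerSemicontinuousOn (P.f i) (Set.Icc (0 : ℝ) (P.d i)))
    {y : ℕ → ℝ} (hy : P.IsFeasible v w y) :
    ∃ x, P.IsOptimal v w x ∧ ∀ z, P.IsOptimal v w z →
      ∑ k ∈ P.vars v w, |x k - y k| ≤ ∑ k ∈ P.vars v w, |z k - y k| := by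
  have hK := P.isCompact_normalizedFeasible v w
  have hf := lowerSemicontinuousOn_cost (v := v) hwm hlsc
  obtain ⟨y', hy', -⟩ := exists_normalized hwm hy
  obtain ⟨x₀, hx₀, hmin⟩ := hf.exists_isMinOn ⟨y', hy'⟩ hK
  have hopt : ∀ z, P.IsFeasible v w z → P.cost v w x₀ ≤ P.cost v w z := fun z hz => by
    obtain ⟨z', hz', hzz⟩ := exists_normalized hwm hz
    rw [← cost_congr hzz]
    exact hmin hz'
  have hM := hf.isCompact_inter_preimage_Iic hK (P.cost v w x₀)
  obtain ⟨x, hx, hxmin⟩ := hM.exists_isMinOn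
    (f := fun z : ℕ → ℝ => ∑ k ∈ P.vars v w, |z k - y k|) ⟨x₀, hx₀, by simp⟩ (by fun_prop)
  refine ⟨x, ⟨hx.1.1, fun z hz => le_trans hx.2 (hopt z hz)⟩, fun z hz => ?_⟩
  obtain ⟨z', hz', hzz⟩ := exists_normalized hwm hz.1
  have h1 : z' ∈ P.normalizedFeasible v w ∩ P.cost v w ⁻¹' Set.Iic (P.cost v w x₀) :=
    ⟨hz', (cost_congr hzz).le.trans (hz.2 x₀ hx₀.1)⟩
  exact (hxmin h1).trans (Finset.sum_congr rfl fun k hk => by rw [hzz k hk]).le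

/-! ### Splitting `Nested(v,w)` at `t` -/

lemma sum_prefix_split (P : NestedProblem) {b : ℕ} (h1 : P.s (v - 1) ≤ P.s t) (h2 : P.s t ≤ b)
    (g : ℕ → ℝ) :
    ∑ k ∈ Finset.Icc (P.s (v - 1) + 1) b, g k =
      ∑ k ∈ P.vars v t, g k + ∑ k ∈ Finset.Icc (P.s t + 1) b, g k := by
  rw [vars, ← Finset.sum_union]
  · congr 1
    ext k
    simp only [Finset.mem_union, Finset.mem_Icc]
    omega
  · rw [Finset.disjoint_left]
    intro k
    simp only [Finset.mem_Icc]
    omega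

lemma cost_split (hvt : v ≤ t) (htw : t ≤ w) (hwm : w ≤ P.m) (x : ℕ → ℝ) :
    P.cost v w x = P.cost v t x + P.cost (t + 1) w x :=
  P.sum_prefix_split (P.s_le_s (by omega) (by omega)) (P.s_le_s htw hwm) fun k => P.f k (x k)

lemma vars_left_subset (htw : t ≤ w) (hwm : w ≤ P.m) : P.vars v t ⊆ P.vars v w :=
  Finset.Icc_subset_Icc le_rfl (P.s_le_s htw hwm)

lemma vars_right_subset (hvt : v ≤ t) (htw : t ≤ w) (hwm : w ≤ P.m) :
    P.vars (t + 1) w ⊆ P.vars v w :=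
  Finset.Icc_subset_Icc (Nat.succ_le_succ (P.s_le_s (by omega) (by omega))) le_rfl

lemma isFeasible_of_split {y : ℕ → ℝ} (hvt : v ≤ t) (htw : t ≤ w) (hwm : w ≤ P.m)
    (h1 : P.IsFeasible v t y) (h2 : P.IsFeasible (t + 1) w y) : P.IsFeasible v w y := by
  have hs : P.s (v - 1) ≤ P.s t := P.s_le_s (by omega) (by omega)
  have hst := P.s_le_s htw hwm
  refine ⟨fun q hq => ?_, ?_, fun k hk => ?_⟩
  · rw [Finset.mem_Ico] at hq
    rcases lt_trichotomy q t with h | rfl | h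
    · exact h1.1 q (Finset.mem_Ico.2 ⟨hq.1, h⟩)
    · exact h1.2.1.le
    · rw [P.sum_prefix_split hs (P.s_le_s h.le (by omega)), h1.2.1]
      have := h2.1 q (Finset.mem_Ico.2 ⟨h, hq.2⟩)
      simp only [Nat.add_sub_cancel] at this
      linarith
  · rw [vars, P.sum_prefix_split hs hst, h1.2.1]
    have := h2.2.1
    simp only [vars, Nat.add_sub_cancel] at this
    linarith
  · by_cases hkt : k ≤ P.s t
    · refine h1.2.2 k ?_
      simp only [vars, Finset.mem_Icc] at hk ⊢
      omega
    · refine h2.2.2 k ?_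
      simp only [vars, Finset.mem_Icc, Nat.add_sub_cancel] at hk ⊢
      omega

lemma IsFeasible.left {z : ℕ → ℝ} (htw : t ≤ w) (hwm : w ≤ P.m)
    (hz : P.IsFeasible v w z)
    (hzt : ∑ k ∈ P.vars v t, z k = (P.abar t : ℝ) - P.abar (v - 1)) : P.IsFeasible v t z :=
  ⟨fun q hq => hz.1 q (Finset.Ico_subset_Ico_right htw hq), hzt,
    fun k hk => hz.2.2 k (vars_left_subset htw hwm hk)⟩

lemma IsFeasible.right {z : ℕ → ℝ} (hvt : v ≤ t) (htw : t ≤ w) (hwm : w ≤ P.m)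
    (hz : P.IsFeasible v w z)
    (hzt : ∑ k ∈ P.vars v t, z k = (P.abar t : ℝ) - P.abar (v - 1)) :
    P.IsFeasible (t + 1) w z := by
  have hs : P.s (v - 1) ≤ P.s t := P.s_le_s (by omega) (by omega)
  refine ⟨fun q hq => ?_, ?_, fun k hk => hz.2.2 k (vars_right_subset hvt htw hwm hk)⟩
  · rw [Finset.mem_Ico] at hq
    have := hz.1 q (Finset.mem_Ico.2 ⟨by omega, hq.2⟩)
    rw [P.sum_prefix_split hs (P.s_le_s (by omega) (by omega)), hzt] at this
    simp only [Nat.add_sub_cancel]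
    linarith
  · have := hz.2.1
    rw [vars, P.sum_prefix_split hs (P.s_le_s htw hwm), hzt] at this
    simp only [vars, Nat.add_sub_cancel]
    linarith

lemma IsFeasible.sum_left_le {x : ℕ → ℝ} (hvt : v ≤ t) (htw : t ≤ w)
    (hx : P.IsFeasible v w x) :
    ∑ k ∈ P.vars v t, x k ≤ (P.abar t : ℝ) - P.abar (v - 1) := by
  rcases htw.lt_or_eq with h | rfl
  · exact hx.1 t (Finset.mem_Ico.2 ⟨hvt, h⟩)
  · exact hx.2.1.le

/-- The exchange contradicts the choice of `x` as an optimal solution closest to `y`: if `y` is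
cheapest among the feasible points with its own first block sum, then no pair of coordinates of the
same block can be used for an exchange between `x` and `y`. Here `D k` stands for a partial sum of
`x - y`, and the coordinates of the pair are `i + 1` and `j + 1`. -/
lemma not_exchange_pair (hwm : w ≤ P.m) {x y : ℕ → ℝ}
    (hx : P.IsOptimal v w x) (hy : P.IsFeasible v w y)
    (hxy : ∀ z, P.IsOptimal v w z →
      ∑ k ∈ P.vars v w, |x k - y k| ≤ ∑ k ∈ P.vars v w, |z k - y k|)
    (hopt : ∀ z, P.IsFeasible v w z → ∑ k ∈ P.vars v t, z k = ∑ k ∈ P.vars v t, y k →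
      P.cost v w y ≤ P.cost v w z)
    {D : ℕ → ℝ} (hD : ∀ k, D k = ∑ q ∈ Finset.Icc (P.s (v - 1) + 1) k, x q -
      ∑ q ∈ Finset.Icc (P.s (v - 1) + 1) k, y q)
    {i j : ℕ} (hi : i + 1 ∈ P.vars v w) (hj : j + 1 ∈ P.vars v w) (hij : i < j)
    (hblock : i + 1 ∈ P.vars v t ↔ j + 1 ∈ P.vars v t) :
    ¬ ((D i < D (i + 1) ∧ D (j + 1) < D j ∧ ∀ k, i < k → k ≤ j → 0 < D k) ∨
       (D (i + 1) < D i ∧ D j < D (j + 1) ∧ ∀ k, i < k → k ≤ j → D k < 0)) := by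
  have hstep : ∀ k, k + 1 ∈ P.vars v w → D (k + 1) = D k + (x (k + 1) - y (k + 1)) := by
    intro k hk
    have hk1 := (Finset.mem_Icc.1 hk).1
    rw [hD, hD, Finset.sum_Icc_succ_top hk1, Finset.sum_Icc_succ_top hk1]
    ring
  rw [hstep i hi, hstep j hj]
  rintro (⟨h1, h2, h3⟩ | ⟨h1, h2, h3⟩)
  · obtain ⟨ε, f1, f2, hc, d1, -⟩ := exists_shift hwm hx.1 hy hi hj (by omega)
      (by linarith) (by linarith) fun k hik hkj => by
        have := h3 k (by omega) (by omega)
        rw [hD] at this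
        linarith
    have h4 := hopt _ f2 (sum_shift_eq _ _ hblock)
    have h5 := hxy _ ⟨f1, fun z hz => by linarith [hx.2 z hz]⟩
    linarith
  · obtain ⟨ε, f1, f2, hc, -, d2⟩ := exists_shift hwm hy hx.1 hi hj (by omega)
      (by linarith) (by linarith) fun k hik hkj => by
        have := h3 k (by omega) (by omega)
        rw [hD] at this
        linarith
    have h4 := hopt _ f1 (sum_shift_eq _ _ hblock)
    have h5 := hxy _ ⟨f2, fun z hz => by linarith [hx.2 z hz]⟩
    linarith

end NestedProblem

open NestedProblem in
theorem theorem2 (P : NestedProblem)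
    (hlsc : ∀ i ∈ Finset.Icc 1 P.n,
      LowerSemicontinuousOn (P.f i) (Set.Icc (0 : ℝ) (P.d i)))
    (v t w : ℕ) (hv : 1 ≤ v) (hvt : v ≤ t) (htw : t ≤ w) (hwm : w ≤ P.m) (hvw : v < w)
    (xdown xup : ℕ → ℝ)
    (hdown : P.IsOptimal v t xdown) (hup : P.IsOptimal (t + 1) w xup) :
    ∃ x : ℕ → ℝ, P.IsOptimal v w x ∧
      (∀ i ∈ P.vars v t, x i ≤ xdown i) ∧
      (∀ i ∈ P.vars (t + 1) w, xup i ≤ x i) := by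
  have hs : P.s (v - 1) ≤ P.s t := P.s_le_s (by omega) (by omega)
  have hst := P.s_le_s htw hwm
  obtain ⟨y, hyd, hyu⟩ : ∃ y : ℕ → ℝ, (∀ k ∈ P.vars v t, y k = xdown k) ∧
      (∀ k ∈ P.vars (t + 1) w, y k = xup k) := by
    refine ⟨fun k => if k ≤ P.s t then xdown k else xup k, fun k hk => ?_, fun k hk => ?_⟩
    · simp [(Finset.mem_Icc.1 hk).2]
    · have := (Finset.mem_Icc.1 hk).1
      simp only [Nat.add_sub_cancel] at this
      simp [show ¬ k ≤ P.s t by omega]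
  have hy1 : P.IsFeasible v t y := hdown.1.congr (by omega) hyd
  have hy2 : P.IsFeasible (t + 1) w y := hup.1.congr hwm hyu
  have hy : P.IsFeasible v w y := isFeasible_of_split hvt htw hwm hy1 hy2
  have hopt : ∀ z, P.IsFeasible v w z → ∑ k ∈ P.vars v t, z k = ∑ k ∈ P.vars v t, y k →
      P.cost v w y ≤ P.cost v w z := by
    intro z hz hzt
    rw [hy1.2.1] at hzt
    rw [cost_split hvt htw hwm, cost_split hvt htw hwm, cost_congr hyd, cost_congr hyu]
    exact add_le_add (hdown.2 z (hz.left htw hwm hzt)) (hup.2 z (hz.right hvt htw hwm hzt))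
  obtain ⟨x, hx, hxy⟩ := exists_closest_optimal hwm hlsc hy
  refine ⟨x, hx, ?_⟩
  obtain ⟨D, hD⟩ : ∃ D : ℕ → ℝ, ∀ k, D k = ∑ q ∈ Finset.Icc (P.s (v - 1) + 1) k, x q -
      ∑ q ∈ Finset.Icc (P.s (v - 1) + 1) k, y q := ⟨_, fun _ => rfl⟩
  have hD0 : D (P.s (v - 1)) = 0 := by simp [hD]
  have hDt : D (P.s t) ≤ 0 := by
    have h1 := hx.1.sum_left_le hvt htw
    have h2 := hy1.2.1
    simp only [vars] at h1 h2
    rw [hD]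
    linarith
  have hDw : D (P.s w) = 0 := by
    have h1 := hx.1.2.1
    have h2 := hy.2.1
    simp only [vars] at h1 h2
    rw [hD]
    linarith
  have hstep : ∀ k, P.s (v - 1) ≤ k → D (k + 1) = D k + (x (k + 1) - y (k + 1)) := by
    intro k hk
    rw [hD, hD, Finset.sum_Icc_succ_top (by omega), Finset.sum_Icc_succ_top (by omega)]
    ring
  constructor
  · intro p hp
    rw [← hyd p hp]
    by_contra! hlt
    simp only [vars, Finset.mem_Icc] at hp
    obtain ⟨p, rfl⟩ : ∃ p', p = p' + 1 := ⟨p - 1, by omega⟩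
    obtain ⟨i, j, hi, hij, hj, h⟩ := exists_exchange_pair (D := D) (l := P.s (v - 1)) (p := p)
      (r := P.s t) (by omega) (by omega) hD0.ge hDt (by rw [hstep p (by omega)]; linarith)
    refine not_exchange_pair (t := t) hwm hx hy hxy hopt hD ?_ ?_ hij ?_ h <;>
      simp only [vars, Finset.mem_Icc] <;> omega
  · intro p hp
    rw [← hyu p hp]
    by_contra! hlt
    simp only [vars, Finset.mem_Icc, Nat.add_sub_cancel] at hp
    obtain ⟨p, rfl⟩ : ∃ p', p = p' + 1 := ⟨p - 1, by omega⟩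
    -- On the second block the signs are reversed, so the crossing argument is applied to `-D`.
    obtain ⟨i, j, hi, hij, hj, h⟩ := exists_exchange_pair (D := fun k => -D k) (l := P.s t) (p := p)
      (r := P.s w) (by omega) (by omega) (by linarith) (by linarith)
      (by simp only [hstep p (by omega)]; linarith)
    simp only [neg_lt_neg_iff, Left.neg_pos_iff, Left.neg_neg_iff] at h
    refine not_exchange_pair (t := t) hwm hx hy hxy hopt hD ?_ ?_ hij ?_ h.symm <;>
      simp only [vars, Finset.mem_Icc] <;> omega
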